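/- Let $K$ be a simplicial 2-complex given by a (locally finite, topological) triangulation of an open domain, i.e. a non-empty connected open set, in $\mathbf C$, oriented by the orientation of $\mathbf C$; in particular $K$ has no boundary. Assume that the 1-skeleton of $K$ is a recurrent graph: the simple random walk on it, started at any vertex, almost surely visits every vertex infinitely many times. A *circle packing* $P$ for $K$ is a family of circles $C_P(v)$ in $\mathbf C$ of radii $r_P(v)>0$, indexed by the vertices $v$ of $K$, such that for every positively oriented triangle $\langle u,v,w\rangle$ of $K$ the circles $C_P(u),C_P(v),C_P(w)$ form a positively oriented triple of mutually externally tangent circles (disjointness of interiors for other circles is not required). For a vertex $v$ of a triangle $\triangle=\langle v,u,w\rangle$ put $$\alpha_P(v,\triangle)=\arccos\frac{(r_P(v)+r_P(u))^2+(r_P(v)+r_P(w))^2-(r_P(u)+r_P(w))^2}{2(r_P(v)+r_P(u))(r_P(v)+r_P(w))},$$ and let the *angle sum* of $P$ at $v$ be $\Theta_P(v)=\sum_{\triangle\ni v}\alpha_P(v,\triangle)$, the sum over all triangles of $K$ that contain $v$. For circle packings $P,Q$ for $K$, the *ratio function* from $P$ to $Q$ is the function on the underlying surface of $P$ (identified with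 the polyhedron $|K|$) that equals $r_Q(v)/r_P(v)$ at each vertex $v$ and is affine on each edge and each triangle. Let $P$ and $Q$ be circle packings for $K$ with $\Theta_P(v)=\Theta_Q(v)$ for every vertex $v$ of $K$. Then either the ratio function from $P$ to $Q$ and the ratio function from $Q$ to $P$ are both unbounded, or they are both constant. -/

import Mathlib

open MeasureTheory Filter Topology

noncomputable section

namespace CirclePack

/-- The geometric realization of an abstract simplicial complex, in barycentric coordinates, as a
set of points of `V → ℝ` with the topology of coordinatewise convergence. For locally finite
complexes (the only ones used below) this is the usual topology of the polyhedron. -/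
def realization {V : Type*} (K : AbstractSimplicialComplex V) : Set (V → ℝ) :=
  {x | (∀ v, 0 ≤ x v) ∧ ∃ T ∈ K.faces, Function.support x ⊆ (T : Set V) ∧ ∑ v ∈ T, x v = 1}

/-- A simplicial 2-complex (without boundary) given by a triangulation of an open domain of `ℂ`:
a pure two-dimensional, locally finite complex in which each edge lies on exactly two triangles,
together with a homeomorphism `toPlane` of its geometric realization onto a domain (a non-empty
connected open subset) of `ℂ`. The triangulation is a topological one: the edges need not be
straight. The values of `toPlane` off the realization are irrelevant. -/
structure PlaneTriangulation (V : Type*) extends AbstractSimplicialComplex V where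
  card_le_three : ∀ S ∈ faces, S.card ≤ 3
  exists_triangle : ∀ S ∈ faces, ∃ T ∈ faces, S ⊆ T ∧ T.card = 3
  finite_star : ∀ v : V, {T | T ∈ faces ∧ T.card = 3 ∧ v ∈ T}.Finite
  edge_two : ∀ e ∈ faces, e.card = 2 → {T | T ∈ faces ∧ T.card = 3 ∧ e ⊆ T}.ncard = 2
  toPlane : (V → ℝ) → ℂ
  isOpenEmbedding_toPlane :
    IsOpenEmbedding ((realization toAbstractSimplicialComplex).domRestrict toPlane)
  isConnected_domain : IsConnected (toPlane '' realization toAbstractSimplicialComplex)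

namespace PlaneTriangulation

variable {V : Type*} (K : PlaneTriangulation V)

/-- The set of triangles (2-simplices) of `K`. -/
def triangles : Set (Finset V) := {T | T ∈ K.faces ∧ T.card = 3}

/-- The finite set of triangles of `K` that have `v` as a vertex. -/
def star (v : V) : Finset (Finset V) := (K.finite_star v).toFinset

/-- The underlying polyhedron of `K`, as a set of points in barycentric coordinates. -/
def polyhedron : Set (V → ℝ) := realization K.toAbstractSimplicialComplex

/-- The 1-skeleton of `K`, as a graph. -/
def skeleton [DecidableEq V] : SimpleGraph V where
  Adj u v := u ≠ v ∧ ({u, v} : Finset V) ∈ K.faces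
  symm := ⟨fun _ _ h => ⟨h.1.symm, by rw [Finset.pair_comm]; exact h.2⟩⟩
  loopless := ⟨fun _ h => h.1 rfl⟩

end PlaneTriangulation

/-- The boundary of the triangle `u v w` in barycentric coordinates, as a loop parametrized
piecewise affinely by `t ∈ [0, 3]`, at `u`, `v`, `w`, `u` for `t = 0, 1, 2, 3`. -/
def boundaryLoop {V : Type*} [DecidableEq V] (u v w : V) (t : ℝ) : V → ℝ := fun x =>
  if x = u then max 0 (1 - t) + max 0 (t - 2)
  else if x = v then max 0 (1 - |t - 1|)
  else if x = w then max 0 (1 - |t - 2|)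
  else 0

/-- The barycenter of the triangle `u v w` in barycentric coordinates. -/
def barycenter {V : Type*} [DecidableEq V] (u v w : V) : V → ℝ := fun x =>
  if x = u ∨ x = v ∨ x = w then 1 / 3 else 0

/-- `(u, v, w)` is a positively oriented triangle of `K`, for the orientation induced from `ℂ`:
the image in the plane of the boundary loop `u → v → w → u` winds exactly once, counterclockwise,
around the image of the barycenter (`θ` is a continuous branch of the argument along the loop). -/
def PlaneTriangulation.PosTriangle {V : Type*} [DecidableEq V] (K : PlaneTriangulation V)
    (u v w : V) : Prop :=
  u ≠ v ∧ v ≠ w ∧ w ≠ u ∧ ({u, v, w} : Finset V) ∈ K.faces ∧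
    ∃ θ : ℝ → ℝ, ContinuousOn θ (Set.Icc 0 3) ∧
      (∀ t ∈ Set.Icc (0 : ℝ) 3,
        K.toPlane (boundaryLoop u v w t) - K.toPlane (barycenter u v w) =
          (‖K.toPlane (boundaryLoop u v w t) - K.toPlane (barycenter u v w)‖ : ℂ) *
            Complex.exp (θ t * Complex.I)) ∧
      θ 3 - θ 0 = 2 * Real.pi

/-- For a label `ρ`, the angle at the vertex `v` of the triangle `T = {v, u, w}`,
`arccos (((ρ v + ρ u)² + (ρ v + ρ w)² - (ρ u + ρ w)²) / (2 (ρ v + ρ u) (ρ v + ρ w)))`,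
that is, the angle at `v` of the euclidean triangle with sides `ρ v + ρ u`, `ρ v + ρ w`,
`ρ u + ρ w`. Here `T.erase v = {u, w}`, and `v` is meant to be a vertex of `T`. -/
def angle {V : Type*} [DecidableEq V] (ρ : V → ℝ) (v : V) (T : Finset V) : ℝ :=
  Real.arccos ((∑ x ∈ T.erase v, (ρ v + ρ x) ^ 2 - (∑ x ∈ T.erase v, ρ x) ^ 2) /
    (2 * ∏ x ∈ T.erase v, (ρ v + ρ x)))

/-- The angle sum of the label `ρ` at the vertex `v`. -/
def PlaneTriangulation.angleSum {V : Type*} [DecidableEq V] (K : PlaneTriangulation V)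
    (ρ : V → ℝ) (v : V) : ℝ :=
  ∑ T ∈ K.star v, angle ρ v T

/-- A circle packing for `K`: circles indexed by the vertices of `K` (not necessarily with disjoint
interiors) such that the three circles of each positively oriented triangle `(u, v, w)` are
mutually externally tangent and positively oriented, i.e. their centers are the vertices of a
euclidean triangle in counterclockwise order. -/
structure CirclePacking {V : Type*} [DecidableEq V] (K : PlaneTriangulation V) where
  center : V → ℂ
  radius : V → ℝ
  radius_pos : ∀ v, 0 < radius v
  tangent : ∀ u v w, K.PosTriangle u v w →
    dist (center u) (center v) = radius u + radius v ∧
    dist (center v) (center w) = radius v + radius w ∧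
    dist (center w) (center u) = radius w + radius u
  oriented : ∀ u v w, K.PosTriangle u v w →
    0 < ((starRingEnd ℂ) (center v - center u) * (center w - center u)).im

/-- The angle sum of the circle packing `P` at the vertex `v`. -/
def CirclePacking.angleSum {V : Type*} [DecidableEq V] {K : PlaneTriangulation V}
    (P : CirclePacking K) (v : V) : ℝ :=
  K.angleSum P.radius v

/-- The ratio function from `P` to `Q`, on the underlying surface of `P` (which is the polyhedron
of `K`): at a vertex `v` it is `r_Q(v) / r_P(v)`, and it is affine on each edge and triangle.
The sum is finite, since a point of the polyhedron has at most three non-zero coordinates. -/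
def ratioFunction {V : Type*} [DecidableEq V] {K : PlaneTriangulation V}
    (P Q : CirclePacking K) (x : K.polyhedron) : ℝ :=
  ∑ᶠ v, (x : V → ℝ) v * (Q.radius v / P.radius v)

/-- Boundedness of a (non-negative) real function. -/
def IsBoundedFun {X : Type*} (f : X → ℝ) : Prop := ∃ M : ℝ, ∀ x, |f x| ≤ M

/-- Constancy of a real function. -/
def IsConstantFun {X : Type*} (f : X → ℝ) : Prop := ∃ c : ℝ, ∀ x, f x = c

open Classical in
/-- The transition probabilities of the simple random walk on a (locally finite) graph. -/
def simpleWalk {V : Type*} (G : SimpleGraph V) (v w : V) : ℝ :=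
  if G.Adj v w then 1 / ((G.neighborSet v).ncard : ℝ) else 0

/-- `μ` is the law, on the space of trajectories, of the random walk with transition
probabilities `p` started at `v`. -/
def IsWalkLaw {V : Type*} [DecidableEq V] [MeasurableSpace V] (p : V → V → ℝ) (v : V)
    (μ : Measure (ℕ → V)) : Prop :=
  IsProbabilityMeasure μ ∧ ∀ (n : ℕ) (x : ℕ → V),
    μ.real {ω | ∀ i ≤ n, ω i = x i} =
      (if x 0 = v then 1 else 0) * ∏ i ∈ Finset.range n, p (x i) (x (i + 1))

/-- A random walk is recurrent if, from each starting point, almost surely every vertex is visited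
infinitely many times. (The vertex set is discrete; the law of the walk from `v` is determined
by its finite-dimensional distributions.) -/
def IsRecurrentWalk {V : Type*} [DecidableEq V] (p : V → V → ℝ) : Prop :=
  letI : MeasurableSpace V := ⊤
  ∀ v : V, ∃ μ : Measure (ℕ → V), IsWalkLaw p v μ ∧
    ∀ᵐ ω ∂μ, ∀ w : V, ∃ᶠ n in atTop, ω n = w

/-- A graph is recurrent if its simple random walk is. -/
def IsRecurrentGraph {V : Type*} [DecidableEq V] (G : SimpleGraph V) : Prop :=
  IsRecurrentWalk (simpleWalk G)

end CirclePack

end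

/-!
Move from one label to the other by interpolating the logarithms of the radii linearly. Along the
way the angle at `v` of a triangle has derivative `κ` with respect to the logarithm of the radius
at another vertex `w`, where `κ > 0` is the ratio of the inradius to the length of the edge `v w`,
and is symmetric in `v` and `w`. Integrating, the difference of the angle sums is the Laplacian of
the logarithm of the ratio function for a network on the 1-skeleton, so equal angle sums make this
logarithm harmonic. Since `κ ≤ 1 / 2`, the conductances are bounded, and by Rayleigh monotonicity
the network inherits from the simple random walk the property that vertices have zero capacity. In
such a network Picone's identity shows that positive superharmonic functions are constant, hence so
are subharmonic functions that are bounded above.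
-/

namespace CirclePack

/-- A locally finite electrical network, encoded by the symmetric function of its conductances; two
vertices are adjacent in it when their conductance is nonzero. -/
structure Network (V : Type*) where
  conductance : V → V → ℝ
  conductance_comm : ∀ x y, conductance x y = conductance y x
  conductance_nonneg : ∀ x y, 0 ≤ conductance x y
  finite_support_conductance : ∀ x, (Function.support (conductance x)).Finite

namespace Network

variable {V : Type*} (N : Network V)

/-- The Laplacian of a network, with the sign that makes it a positive operator: a function is
superharmonic when its Laplacian is nonnegative. -/
noncomputable def laplacian (f : V → ℝ) (x : V) : ℝ := ∑ᶠ y, N.conductance x y * (f x - f y)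

/-- The energy of `f` inside the finite set `B`. The sum is over ordered pairs, so each edge is
counted twice. -/
def energyOn (B : Finset V) (f : V → ℝ) : ℝ :=
  ∑ x ∈ B, ∑ y ∈ B, N.conductance x y * (f x - f y) ^ 2

/-- The vertex `o` has zero capacity to infinity: finitely supported functions that are `1` at `o`
have arbitrarily small energy. -/
def HasZeroCapacity (o : V) : Prop :=
  ∀ ε > 0, ∃ f : V → ℝ, (Function.support f).Finite ∧ f o = 1 ∧ ∀ B, N.energyOn B f ≤ ε

variable {N}

theorem laplacian_eq_sum {x : V} {B : Finset V} (hB : Function.support (N.conductance x) ⊆ B)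
    (f : V → ℝ) : N.laplacian f x = ∑ y ∈ B, N.conductance x y * (f x - f y) :=
  finsum_eq_sum_of_support_subset _ fun _ hy => hB (left_ne_zero_of_mul hy)

theorem laplacian_const_sub (a : ℝ) (f : V → ℝ) (x : V) :
    N.laplacian (fun y => a - f y) x = -N.laplacian f x := by
  rw [laplacian, laplacian, ← finsum_neg_distrib]
  exact finsum_congr fun y => by ring

theorem exists_finset_neighborhood (N : Network V) (B : Finset V) {f : V → ℝ}
    (hf : (Function.support f).Finite) :
    ∃ B' : Finset V, B ⊆ B' ∧
      ∀ x, f x ≠ 0 → x ∈ B' ∧ Function.support (N.conductance x) ⊆ B' := by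
  classical
  let neighbors : Finset V :=
    hf.toFinset.biUnion fun x => (N.finite_support_conductance x).toFinset
  refine ⟨B ∪ (hf.toFinset ∪ neighbors), Finset.subset_union_left,
    fun x hx => ⟨?_, fun y hy => ?_⟩⟩
  · simp [hx]
  · simp only [neighbors, Finset.coe_union, Finset.coe_biUnion, Set.Finite.coe_toFinset]
    exact Or.inr (Or.inr (Set.mem_biUnion hx hy))

theorem energyOn_mono (N : Network V) {B B' : Finset V} (h : B ⊆ B') (f : V → ℝ) :
    N.energyOn B f ≤ N.energyOn B' f := by
  have hterm (x y : V) : 0 ≤ N.conductance x y * (f x - f y) ^ 2 :=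
    mul_nonneg (N.conductance_nonneg x y) (sq_nonneg _)
  calc N.energyOn B f ≤ ∑ x ∈ B, ∑ y ∈ B', N.conductance x y * (f x - f y) ^ 2 :=
        Finset.sum_le_sum fun x _ =>
          Finset.sum_le_sum_of_subset_of_nonneg h fun y _ _ => hterm x y
    _ ≤ N.energyOn B' f :=
        Finset.sum_le_sum_of_subset_of_nonneg h fun x _ _ => Finset.sum_nonneg fun y _ => hterm x y

theorem sum_conductance_mul_sub_mul_sub {B : Finset V} {g : V → ℝ}
    (hB : ∀ x, g x ≠ 0 → x ∈ B ∧ Function.support (N.conductance x) ⊆ B) (w : V → ℝ) :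
    ∑ x ∈ B, ∑ y ∈ B, N.conductance x y * ((w x - w y) * (g x - g y)) =
      2 * ∑ᶠ x, g x * N.laplacian w x := by
  set S := ∑ x ∈ B, ∑ y ∈ B, g x * (N.conductance x y * (w x - w y)) with hS
  have hlaplacian : ∑ᶠ x, g x * N.laplacian w x = S := by
    rw [finsum_eq_sum_of_support_subset _ fun x hx => (hB x (left_ne_zero_of_mul hx)).1]
    refine Finset.sum_congr rfl fun x _ => ?_
    by_cases hx : g x = 0
    · simp [hx]
    · rw [laplacian_eq_sum (hB x hx).2, Finset.mul_sum]
  have hswap : ∑ x ∈ B, ∑ y ∈ B, g y * (N.conductance x y * (w x - w y)) = -S := by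
    rw [hS, Finset.sum_comm]
    simp_rw [← Finset.sum_neg_distrib]
    exact Finset.sum_congr rfl fun x _ => Finset.sum_congr rfl fun y _ => by
      rw [N.conductance_comm y x]; ring
  calc ∑ x ∈ B, ∑ y ∈ B, N.conductance x y * ((w x - w y) * (g x - g y))
      = S - ∑ x ∈ B, ∑ y ∈ B, g y * (N.conductance x y * (w x - w y)) := by
        simp_rw [hS, ← Finset.sum_sub_distrib]
        exact Finset.sum_congr rfl fun x _ => Finset.sum_congr rfl fun y _ => by ring
    _ = 2 * ∑ᶠ x, g x * N.laplacian w x := by rw [hswap, hlaplacian]; ring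

theorem energyOn_le_finsum (N : Network V) {f : V → ℝ} (hf : (Function.support f).Finite)
    (B : Finset V) : N.energyOn B f ≤ 2 * ∑ᶠ x, f x * N.laplacian f x := by
  obtain ⟨B', hBB', hB'⟩ := N.exists_finset_neighborhood B hf
  rw [← sum_conductance_mul_sub_mul_sub hB']
  simpa only [energyOn, sq] using N.energyOn_mono hBB' f

theorem HasZeroCapacity.of_conductance_le {N' : Network V} {o : V} (h : N.HasZeroCapacity o) {C : ℝ}
    (hC : ∀ x y, N'.conductance x y ≤ C * N.conductance x y) : N'.HasZeroCapacity o := by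
  intro ε hε
  have hC' : 0 < |C| + 1 := by positivity
  obtain ⟨f, hf, hfo, henergy⟩ := h (ε / (|C| + 1)) (by positivity)
  refine ⟨f, hf, hfo, fun B => ?_⟩
  have hle (x y : V) : N'.conductance x y ≤ (|C| + 1) * N.conductance x y :=
    (hC x y).trans (mul_le_mul_of_nonneg_right (by linarith [le_abs_self C])
      (N.conductance_nonneg x y))
  calc N'.energyOn B f ≤ (|C| + 1) * N.energyOn B f := by
        simp only [energyOn, Finset.mul_sum, ← mul_assoc]
        exact Finset.sum_le_sum fun x _ => Finset.sum_le_sum fun y _ =>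
          mul_le_mul_of_nonneg_right (hle x y) (sq_nonneg _)
    _ ≤ ε := (le_div_iff₀' hC').1 (henergy B)

section Superharmonic

variable {w : V → ℝ}

theorem sum_picone_le_energyOn (hw : ∀ x, 0 < w x) (hsuper : ∀ x, 0 ≤ N.laplacian w x)
    {B : Finset V} {f : V → ℝ}
    (hB : ∀ x, f x ≠ 0 → x ∈ B ∧ Function.support (N.conductance x) ⊆ B) :
    ∑ x ∈ B, ∑ y ∈ B, N.conductance x y * ((f x * w y - f y * w x) ^ 2 / (w x * w y)) ≤
      N.energyOn B f := by
  have hpicone : N.energyOn B f =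
      ∑ x ∈ B, ∑ y ∈ B, N.conductance x y * ((f x * w y - f y * w x) ^ 2 / (w x * w y)) +
        ∑ x ∈ B, ∑ y ∈ B,
          N.conductance x y * ((w x - w y) * (f x ^ 2 / w x - f y ^ 2 / w y)) := by
    simp_rw [energyOn, ← Finset.sum_add_distrib]
    refine Finset.sum_congr rfl fun x _ => Finset.sum_congr rfl fun y _ => ?_
    have hx := (hw x).ne'
    have hy := (hw y).ne'
    field_simp
    ring
  have hnonneg : 0 ≤ ∑ᶠ x, f x ^ 2 / w x * N.laplacian w x := finsum_nonneg fun x =>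
    mul_nonneg (div_nonneg (sq_nonneg _) (hw x).le) (hsuper x)
  rw [hpicone, sum_conductance_mul_sub_mul_sub (g := fun x => f x ^ 2 / w x)
    fun x hx => hB x fun h => hx (by simp [h])]
  linarith

theorem conductance_mul_sq_sub_le (hw : ∀ x, 0 < w x) (hsuper : ∀ x, 0 ≤ N.laplacian w x)
    {o : V} {f : V → ℝ} (hf : (Function.support f).Finite) (hfo : f o = 1) {ε : ℝ}
    (henergy : ∀ B, N.energyOn B f ≤ ε) (z : V) :
    N.conductance o z * (w z - w o) ^ 2 ≤ 2 * (w o * w z + w o ^ 2) * ε := by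
  classical
  obtain ⟨B, hozB, hB⟩ := N.exists_finset_neighborhood {o, z} hf
  have hterm {F : V → V → ℝ} (hF : ∀ x y, 0 ≤ F x y) (hFε : ∑ x ∈ B, ∑ y ∈ B, F x y ≤ ε) :
      F o z ≤ ε := calc
    F o z ≤ ∑ y ∈ B, F o y := Finset.single_le_sum (fun y _ => hF o y) (hozB (by simp))
    _ ≤ ∑ x ∈ B, ∑ y ∈ B, F x y := Finset.single_le_sum (f := fun x => ∑ y ∈ B, F x y)
      (fun x _ => Finset.sum_nonneg fun y _ => hF x y) (hozB (by simp))
    _ ≤ ε := hFε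
  have hf_edge := hterm (fun x y => mul_nonneg (N.conductance_nonneg x y) (sq_nonneg _))
    (henergy B)
  have hpicone_edge := hterm (fun x y => mul_nonneg (N.conductance_nonneg x y)
      (div_nonneg (sq_nonneg _) (mul_pos (hw x) (hw y)).le))
    ((sum_picone_le_energyOn hw hsuper hB).trans (henergy B))
  simp only [hfo, one_mul] at hf_edge hpicone_edge
  rw [← mul_div_assoc, div_le_iff₀ (mul_pos (hw o) (hw z))] at hpicone_edge
  calc N.conductance o z * (w z - w o) ^ 2
      ≤ N.conductance o z * (2 * (w z - f z * w o) ^ 2 + 2 * ((1 - f z) ^ 2 * w o ^ 2)) := by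
        gcongr
        · exact N.conductance_nonneg o z
        · nlinarith [sq_nonneg ((w z - f z * w o) + (1 - f z) * w o)]
    _ = 2 * (N.conductance o z * (w z - f z * w o) ^ 2) +
          2 * (N.conductance o z * (1 - f z) ^ 2) * w o ^ 2 := by ring
    _ ≤ 2 * (ε * (w o * w z)) + 2 * ε * w o ^ 2 := by gcongr
    _ = 2 * (w o * w z + w o ^ 2) * ε := by ring

theorem HasZeroCapacity.eq_of_superharmonic {o z : V} (ho : N.HasZeroCapacity o)
    (hw : ∀ x, 0 < w x) (hsuper : ∀ x, 0 ≤ N.laplacian w x) (hoz : 0 < N.conductance o z) :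
    w z = w o := by
  have hM : 0 < 2 * (w o * w z + w o ^ 2) := by
    have := hw o
    have := hw z
    positivity
  have hnonpos : N.conductance o z * (w z - w o) ^ 2 ≤ 0 :=
    le_of_forall_pos_le_add fun δ hδ => by
      obtain ⟨f, hf, hfo, henergy⟩ := ho (δ / (2 * (w o * w z + w o ^ 2))) (by positivity)
      have := conductance_mul_sq_sub_le hw hsuper hf hfo henergy z
      rwa [mul_div_cancel₀ _ hM.ne', ← zero_add δ] at this
  have hsq : (w z - w o) ^ 2 = 0 :=
    le_antisymm (nonpos_of_mul_nonpos_right hnonpos hoz) (sq_nonneg _)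
  exact sub_eq_zero.1 (pow_eq_zero_iff two_ne_zero |>.1 hsq)

end Superharmonic

theorem eq_of_subharmonic_of_bddAbove (hcap : ∀ o, N.HasZeroCapacity o)
    (hconn : ∀ x y, Relation.ReflTransGen (fun a b => 0 < N.conductance a b) x y)
    {u : V → ℝ} (hu : BddAbove (Set.range u)) (hsub : ∀ x, N.laplacian u x ≤ 0) (x y : V) :
    u x = u y := by
  obtain ⟨M, hM⟩ := hu
  have hstep {a b : V} (hab : 0 < N.conductance a b) : u a = u b := by
    have := (hcap a).eq_of_superharmonic (w := fun x => M + 1 - u x)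
      (fun x => by linarith [hM (Set.mem_range_self x)])
      (fun x => by rw [laplacian_const_sub]; linarith [hsub x]) hab
    linarith
  have h := hconn x y
  induction h with
  | refl => rfl
  | tail _ hbc ih => exact ih.trans (hstep hbc)

end Network

section SimpleRandomWalk

variable {V : Type*}

section CylinderSets

variable [DecidableEq V] [MeasurableSpace V] {p : V → V → ℝ} {v : V} {μ : Measure (ℕ → V)}

theorem IsWalkLaw.measureReal_cylinder (hμ : IsWalkLaw p v μ) (n : ℕ) (x : ℕ → V) :
    μ.real (PiNat.cylinder x (n + 1)) =
      (if x 0 = v then 1 else 0) * ∏ i ∈ Finset.range n, p (x i) (x (i + 1)) := by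
  rw [← hμ.2]
  simp only [PiNat.cylinder, Nat.lt_succ_iff]

theorem IsWalkLaw.measureReal_cylinder_update (hμ : IsWalkLaw p v μ) (n : ℕ) (x : ℕ → V) (y : V) :
    μ.real (PiNat.cylinder (Function.update x (n + 1) y) (n + 2)) =
      μ.real (PiNat.cylinder x (n + 1)) * p (x n) y := by
  have hprefix (i : ℕ) (hi : i ≤ n) : Function.update x (n + 1) y i = x i :=
    Function.update_of_ne (by omega) _ _
  rw [hμ.measureReal_cylinder, hμ.measureReal_cylinder, Finset.prod_range_succ, ← mul_assoc,
    hprefix 0 n.zero_le, hprefix n le_rfl, Function.update_self]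
  congr 2
  refine Finset.prod_congr rfl fun i hi => ?_
  rw [Finset.mem_range] at hi
  rw [hprefix i hi.le, hprefix (i + 1) hi]

theorem IsWalkLaw.ae_zero_eq [MeasurableSingletonClass V] (hμ : IsWalkLaw p v μ) :
    ∀ᵐ ω ∂μ, ω 0 = v := by
  have := hμ.1
  have hstart : μ.real {ω | ω 0 = v} = 1 := by
    simpa using hμ.2 0 fun _ => v
  have hmeas : MeasurableSet {ω : ℕ → V | ω 0 = v} :=
    (measurableSet_singleton v).preimage (measurable_pi_apply 0)
  exact (mem_ae_iff_prob_eq_one hmeas).2 ((ENNReal.toReal_eq_one_iff _).1 hstart)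

end CylinderSets

theorem IsRecurrentWalk.countable [DecidableEq V] {p : V → V → ℝ} (hp : IsRecurrentWalk p) :
    Countable V := by
  rcases isEmpty_or_nonempty V with _ | ⟨⟨v⟩⟩
  · infer_instance
  obtain ⟨μ, hμ, hvisit⟩ := hp v
  have := hμ.1
  obtain ⟨ω, hω⟩ := hvisit.exists
  exact Function.Surjective.countable (f := ω) fun w => (hω w).exists

variable (G : SimpleGraph V) [G.LocallyFinite]

open Classical in
/-- The probability that the simple random walk on `G` started at `x` is at `o` at time `k`. -/
noncomputable def transition (o : V) : ℕ → V → ℝ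
  | 0 => Pi.single o 1
  | k + 1 => fun x => (∑ y ∈ G.neighborFinset x, transition o k y) / G.degree x

variable {G}

theorem transition_nonneg (o : V) (k : ℕ) (x : V) : 0 ≤ transition G o k x := by
  classical
  induction k generalizing x with
  | zero => exact (Pi.single_nonneg.2 zero_le_one : (0 : V → ℝ) ≤ Pi.single o 1) x
  | succ k ih => exact div_nonneg (Finset.sum_nonneg fun y _ => ih y) (Nat.cast_nonneg _)

theorem exists_adj_of_transition_succ_ne_zero {o x : V} {k : ℕ}
    (h : transition G o (k + 1) x ≠ 0) : ∃ y, G.Adj x y ∧ transition G o k y ≠ 0 := by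
  rw [transition, div_ne_zero_iff] at h
  obtain ⟨y, hy, hy0⟩ := Finset.exists_ne_zero_of_sum_ne_zero h.1
  exact ⟨y, by simpa using hy, hy0⟩

theorem finite_support_transition (o : V) (k : ℕ) :
    (Function.support (transition G o k)).Finite := by
  classical
  induction k with
  | zero => exact (Set.finite_singleton o).subset Pi.support_single_subset
  | succ k ih =>
    refine (ih.biUnion fun y _ => (G.neighborFinset y).finite_toSet).subset fun x hx => ?_
    obtain ⟨y, hxy, hy⟩ := exists_adj_of_transition_succ_ne_zero hx
    exact Set.mem_biUnion hy (by simpa using hxy.symm)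

theorem reachable_of_transition_ne_zero {o x : V} {k : ℕ} (h : transition G o k x ≠ 0) :
    G.Reachable x o := by
  classical
  induction k generalizing x with
  | zero =>
    obtain rfl : x = o := by simpa using Pi.support_single_subset (Function.mem_support.2 h)
    exact SimpleGraph.Reachable.rfl
  | succ k ih =>
    obtain ⟨y, hxy, hy⟩ := exists_adj_of_transition_succ_ne_zero h
    exact hxy.reachable.trans (ih hy)

theorem simpleWalk_of_adj {x y : V} (h : G.Adj x y) : simpleWalk G x y = 1 / G.degree x := by
  rw [simpleWalk, if_pos h, Set.ncard_eq_toFinset_card', ← SimpleGraph.neighborFinset,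
    SimpleGraph.card_neighborFinset_eq_degree]

section Law

variable [DecidableEq V] [Countable V] [MeasurableSpace V] {v : V} {μ : Measure (ℕ → V)}

theorem IsWalkLaw.measureReal_cylinder_diff (hμ : IsWalkLaw (simpleWalk G) v μ)
    (n : ℕ) (x : ℕ → V) :
    μ.real (PiNat.cylinder x (n + 1) \ ⋃ y ∈ G.neighborFinset (x n),
      PiNat.cylinder (Function.update x (n + 1) y) (n + 2)) = 0 := by
  have := hμ.1
  have hnull (y : V) (hy : y ∉ G.neighborFinset (x n)) :
      μ (PiNat.cylinder (Function.update x (n + 1) y) (n + 2)) = 0 := by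
    rw [G.mem_neighborFinset] at hy
    rw [← measureReal_eq_zero_iff, hμ.measureReal_cylinder_update, simpleWalk, if_neg hy, mul_zero]
  rw [measureReal_eq_zero_iff]
  refine measure_mono_null (fun ω hω => ?_) (measure_iUnion_null fun y : V =>
    measure_iUnion_null fun hy : y ∉ G.neighborFinset (x n) => hnull y hy)
  obtain ⟨hx, hnot⟩ := hω
  rw [← PiNat.iUnion_cylinder_update x (n + 1), Set.mem_iUnion] at hx
  obtain ⟨y, hy⟩ := hx
  exact Set.mem_iUnion₂.2 ⟨y, fun hadj => hnot (Set.mem_iUnion₂.2 ⟨y, hadj, hy⟩), hy⟩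

theorem IsWalkLaw.measureReal_cylinder_inter_le_sum (hμ : IsWalkLaw (simpleWalk G) v μ)
    (n : ℕ) (x : ℕ → V) (A : Set (ℕ → V)) :
    μ.real (PiNat.cylinder x (n + 1) ∩ A) ≤ ∑ y ∈ G.neighborFinset (x n),
      μ.real (PiNat.cylinder (Function.update x (n + 1) y) (n + 2) ∩ A) := by
  have := hμ.1
  set next : V → Set (ℕ → V) := fun y => PiNat.cylinder (Function.update x (n + 1) y) (n + 2)
  have hcover : PiNat.cylinder x (n + 1) ∩ A ⊆
      (PiNat.cylinder x (n + 1) \ ⋃ y ∈ G.neighborFinset (x n), next y) ∪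
        ⋃ y ∈ G.neighborFinset (x n), next y ∩ A := by
    rintro ω ⟨hx, hA⟩
    by_cases h : ω ∈ ⋃ y ∈ G.neighborFinset (x n), next y
    · obtain ⟨y, hy, hω⟩ := Set.mem_iUnion₂.1 h
      exact Or.inr (Set.mem_iUnion₂.2 ⟨y, hy, hω, hA⟩)
    · exact Or.inl ⟨hx, h⟩
  calc μ.real (PiNat.cylinder x (n + 1) ∩ A)
      ≤ μ.real (⋃ y ∈ G.neighborFinset (x n), next y ∩ A) := by
        refine (measureReal_mono hcover).trans ((measureReal_union_le _ _).trans_eq ?_)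
        rw [hμ.measureReal_cylinder_diff, zero_add]
    _ ≤ ∑ y ∈ G.neighborFinset (x n), μ.real (next y ∩ A) := measureReal_biUnion_finset_le _ _

theorem IsWalkLaw.measureReal_cylinder_inter_le (hμ : IsWalkLaw (simpleWalk G) v μ)
    (o : V) (k n : ℕ) (x : ℕ → V) :
    μ.real (PiNat.cylinder x (n + 1) ∩ {ω | ω (n + k) = o}) ≤
      μ.real (PiNat.cylinder x (n + 1)) * transition G o k (x n) := by
  have := hμ.1
  induction k generalizing n x with
  | zero =>
    by_cases h : x n = o
    · simpa [transition, h] using measureReal_mono Set.inter_subset_left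
    · have hempty : PiNat.cylinder x (n + 1) ∩ {ω | ω (n + 0) = o} = ∅ :=
        Set.eq_empty_of_forall_notMem fun ω hω => h ((hω.1 n n.lt_succ_self).symm.trans hω.2)
      rw [hempty]
      simp [transition, h]
  | succ k ih =>
    set next : V → Set (ℕ → V) := fun y => PiNat.cylinder (Function.update x (n + 1) y) (n + 2)
    rw [show n + (k + 1) = n + 1 + k by ring]
    calc μ.real (PiNat.cylinder x (n + 1) ∩ {ω | ω (n + 1 + k) = o})
        ≤ ∑ y ∈ G.neighborFinset (x n), μ.real (next y ∩ {ω | ω (n + 1 + k) = o}) :=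
          hμ.measureReal_cylinder_inter_le_sum n x _
      _ ≤ ∑ y ∈ G.neighborFinset (x n), μ.real (next y) * transition G o k y :=
          Finset.sum_le_sum fun y _ => by
            simpa only [Function.update_self] using ih (n + 1) (Function.update x (n + 1) y)
      _ = μ.real (PiNat.cylinder x (n + 1)) * transition G o (k + 1) (x n) := by
          simp only [transition, Finset.sum_div, Finset.mul_sum]
          refine Finset.sum_congr rfl fun y hy => ?_
          rw [hμ.measureReal_cylinder_update, simpleWalk_of_adj ((G.mem_neighborFinset _ _).1 hy)]
          ring

theorem IsWalkLaw.measureReal_le_transition [MeasurableSingletonClass V]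
    (hμ : IsWalkLaw (simpleWalk G) v μ) (o : V) (k : ℕ) :
    μ.real {ω | ω k = o} ≤ transition G o k v := by
  have := hμ.1
  have hstart : (PiNat.cylinder (fun _ => v) 1 ∩ {ω | ω k = o} : Set (ℕ → V)) =ᵐ[μ]
      {ω | ω k = o} := by
    filter_upwards [hμ.ae_zero_eq] with ω hω
    exact propext ⟨And.right, fun hk => ⟨fun i hi => by rwa [Nat.lt_one_iff.1 hi], hk⟩⟩
  calc μ.real {ω | ω k = o}
      = μ.real (PiNat.cylinder (fun _ => v) 1 ∩ {ω | ω k = o}) := (measureReal_congr hstart).symm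
    _ ≤ μ.real (PiNat.cylinder (fun _ => v) 1) * transition G o k v := by
        simpa using hμ.measureReal_cylinder_inter_le o k 0 fun _ => v
    _ ≤ transition G o k v :=
        mul_le_of_le_one_left (transition_nonneg o k v) measureReal_le_one

end Law

section Recurrence

variable [DecidableEq V]

theorem IsRecurrentGraph.preconnected (hG : IsRecurrentGraph G) : G.Preconnected := by
  intro v o
  let _ : MeasurableSpace V := ⊤
  have := IsRecurrentWalk.countable hG
  obtain ⟨μ, hμ, hvisit⟩ := hG v
  have := hμ.1
  obtain ⟨k, hk⟩ : ∃ k, transition G o k v ≠ 0 := by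
    by_contra! h
    have hnever : ∀ᵐ ω ∂μ, ∀ k, ω k ≠ o := ae_all_iff.2 fun k => by
      have hzero : μ.real {ω | ω k = o} = 0 :=
        le_antisymm ((hμ.measureReal_le_transition o k).trans (h k).le) measureReal_nonneg
      exact measure_eq_zero_iff_ae_notMem.1 ((measureReal_eq_zero_iff).1 hzero)
    obtain ⟨ω, hvisit, hnever⟩ := (hvisit.and hnever).exists
    obtain ⟨k, hk⟩ := (hvisit o).exists
    exact hnever k hk
  exact reachable_of_transition_ne_zero hk

theorem IsRecurrentGraph.not_summable_transition (hG : IsRecurrentGraph G) (o : V) :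
    ¬ Summable fun k => transition G o k o := by
  let _ : MeasurableSpace V := ⊤
  have := IsRecurrentWalk.countable hG
  obtain ⟨μ, hμ, hvisit⟩ := hG o
  have := hμ.1
  intro hs
  have hfin : ∑' k, μ {ω | ω k = o} ≠ ⊤ := by
    refine ne_top_of_le_ne_top hs.tsum_ofReal_ne_top (ENNReal.tsum_le_tsum fun k => ?_)
    rw [← ofReal_measureReal]
    exact ENNReal.ofReal_le_ofReal (hμ.measureReal_le_transition o k)
  obtain ⟨ω, hvisit, hfinite⟩ := (hvisit.and (ae_eventually_notMem hfin)).exists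
  obtain ⟨k, hk, hk'⟩ := ((hvisit o).and_eventually hfinite).exists
  exact hk' hk

end Recurrence

section UnitNetwork

variable (G) in
open Classical in
/-- The network on a graph in which every edge has unit conductance. -/
noncomputable def unitNetwork : Network V where
  conductance x y := if G.Adj x y then 1 else 0
  conductance_comm x y := by simp only [G.adj_comm]
  conductance_nonneg x y := by positivity
  finite_support_conductance x := (G.neighborFinset x).finite_toSet.subset fun y hy => by
    simpa using hy

theorem laplacian_unitNetwork (f : V → ℝ) (x : V) :
    (unitNetwork G).laplacian f x = ∑ y ∈ G.neighborFinset x, (f x - f y) := by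
  have hsupport : Function.support ((unitNetwork G).conductance x) ⊆ G.neighborFinset x :=
    fun y hy => by simpa [unitNetwork] using hy
  rw [Network.laplacian_eq_sum hsupport]
  refine Finset.sum_congr rfl fun y hy => ?_
  simp only [unitNetwork, if_pos ((G.mem_neighborFinset x y).1 hy), one_mul]

variable (G) in
/-- The Green function with pole `o`, truncated at time `n`: the expected number of visits to `o`
before time `n` of the simple random walk started at `x`. -/
noncomputable def truncatedGreen (o : V) (n : ℕ) (x : V) : ℝ :=
  ∑ k ∈ Finset.range n, transition G o k x

theorem truncatedGreen_nonneg (o : V) (n : ℕ) (x : V) : 0 ≤ truncatedGreen G o n x :=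
  Finset.sum_nonneg fun k _ => transition_nonneg o k x

theorem finite_support_truncatedGreen (o : V) (n : ℕ) :
    (Function.support (truncatedGreen G o n)).Finite := by
  refine ((Finset.range n).finite_toSet.biUnion fun k _ =>
    finite_support_transition (G := G) o k).subset fun x hx => ?_
  obtain ⟨k, hk, hk0⟩ := Finset.exists_ne_zero_of_sum_ne_zero hx
  exact Set.mem_biUnion hk hk0

theorem laplacian_truncatedGreen (o : V) (n : ℕ) (x : V) :
    (unitNetwork G).laplacian (truncatedGreen G o n) x =
      G.degree x * (transition G o 0 x - transition G o n x) := by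
  have hstep (k : ℕ) :
      ∑ y ∈ G.neighborFinset x, transition G o k y = G.degree x * transition G o (k + 1) x := by
    rcases eq_or_ne (G.degree x) 0 with h | h
    · have hempty : G.neighborFinset x = ∅ :=
        Finset.card_eq_zero.1 ((G.card_neighborFinset_eq_degree x).trans h)
      simp [h, hempty]
    · rw [transition]
      field_simp
  have hsum : ∑ y ∈ G.neighborFinset x, truncatedGreen G o n y =
      G.degree x * ∑ k ∈ Finset.range n, transition G o (k + 1) x := by
    simp only [truncatedGreen]
    rw [Finset.sum_comm, Finset.mul_sum]
    exact Finset.sum_congr rfl fun k _ => hstep k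
  rw [laplacian_unitNetwork, Finset.sum_sub_distrib, hsum, Finset.sum_const,
    SimpleGraph.card_neighborFinset_eq_degree, nsmul_eq_mul, ← mul_sub,
    ← Finset.sum_range_sub' (fun k => transition G o k x), Finset.sum_sub_distrib, truncatedGreen]

theorem energyOn_truncatedGreen_le (o : V) (n : ℕ) (B : Finset V) :
    (unitNetwork G).energyOn B (truncatedGreen G o n) ≤
      2 * (G.degree o * truncatedGreen G o n o) := by
  set g := truncatedGreen G o n
  have hg : (Function.support g).Finite := finite_support_truncatedGreen o n
  have hterm (x : V) : g x * (unitNetwork G).laplacian g x ≤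
      g x * (G.degree x * transition G o 0 x) := by
    rw [laplacian_truncatedGreen]
    have := transition_nonneg (G := G) o n x
    gcongr
    · exact truncatedGreen_nonneg o n x
    · linarith
  calc (unitNetwork G).energyOn B g ≤ 2 * ∑ᶠ x, g x * (unitNetwork G).laplacian g x :=
        Network.energyOn_le_finsum _ hg B
    _ ≤ 2 * ∑ᶠ x, g x * (G.degree x * transition G o 0 x) := by
        gcongr
        exact finsum_le_finsum' (hg.subset fun x => left_ne_zero_of_mul)
          (hg.subset fun x => left_ne_zero_of_mul) hterm
    _ = 2 * (G.degree o * g o) := by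
        rw [finsum_eq_single _ o fun x hx => by simp [transition, hx]]
        simp [transition, mul_comm]

theorem hasZeroCapacity_of_not_summable {o : V} (ho : ¬ Summable fun k => transition G o k o) :
    (unitNetwork G).HasZeroCapacity o := by
  intro ε hε
  rw [not_summable_iff_tendsto_nat_atTop_of_nonneg fun k => transition_nonneg o k o] at ho
  obtain ⟨n, hn, hgo⟩ := ((ho.eventually_ge_atTop (2 * G.degree o / ε)).and
    (ho.eventually_gt_atTop 0)).exists
  set g := truncatedGreen G o n
  replace hgo : 0 < g o := hgo
  refine ⟨fun x => g x / g o, (finite_support_truncatedGreen o n).subset fun x hx h =>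
    hx ((congrArg (· / g o) h).trans (zero_div _)), div_self hgo.ne', fun B => ?_⟩
  have hlarge : 2 * (G.degree o : ℝ) ≤ g o * ε := (div_le_iff₀ hε).1 hn
  calc (unitNetwork G).energyOn B (fun x => g x / g o)
      = (unitNetwork G).energyOn B g / g o ^ 2 := by
        simp_rw [Network.energyOn, Finset.sum_div, ← sub_div, div_pow, mul_div_assoc]
    _ ≤ 2 * (G.degree o * g o) / g o ^ 2 := by
        gcongr
        exact energyOn_truncatedGreen_le o n B
    _ = 2 * G.degree o / g o := by field_simp
    _ ≤ ε := (div_le_iff₀' hgo).2 hlarge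

end UnitNetwork

theorem IsRecurrentGraph.eq_of_subharmonic_of_bddAbove [DecidableEq V] (hG : IsRecurrentGraph G)
    {N : Network V} {C : ℝ} (hpos : ∀ x y, G.Adj x y → 0 < N.conductance x y)
    (hle : ∀ x y, N.conductance x y ≤ C * (unitNetwork G).conductance x y)
    {u : V → ℝ} (hu : BddAbove (Set.range u)) (hsub : ∀ x, N.laplacian u x ≤ 0) (x y : V) :
    u x = u y :=
  Network.eq_of_subharmonic_of_bddAbove
    (fun o => (hasZeroCapacity_of_not_summable
      (hG.not_summable_transition o)).of_conductance_le hle)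
    (fun x y => Relation.ReflTransGen.mono hpos _ _
      ((G.reachable_iff_reflTransGen x y).1 (hG.preconnected x y)))
    hu hsub x y

end SimpleRandomWalk

section TangentCircles

open Real

/-- The cosine of the angle at the first center in the triangle of the centers of three mutually
tangent circles of radii `a`, `b`, `c`. -/
noncomputable def tangencyCos (a b c : ℝ) : ℝ := 1 - 2 * (b * c) / ((a + b) * (a + c))

variable {a b c : ℝ}

theorem tangencyCos_eq (ha : 0 < a) (hb : 0 < b) (hc : 0 < c) :
    tangencyCos a b c =
      ((a + b) ^ 2 + (a + c) ^ 2 - (b + c) ^ 2) / (2 * ((a + b) * (a + c))) := by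
  rw [tangencyCos]
  field_simp
  ring

theorem tangencyCos_lt_one (ha : 0 < a) (hb : 0 < b) (hc : 0 < c) : tangencyCos a b c < 1 :=
  sub_lt_self 1 (by positivity)

theorem neg_one_lt_tangencyCos (ha : 0 < a) (hb : 0 < b) (hc : 0 < c) :
    -1 < tangencyCos a b c := by
  have : 2 * (b * c) / ((a + b) * (a + c)) < 2 := by
    rw [div_lt_iff₀ (by positivity)]
    nlinarith [mul_pos ha hb, mul_pos ha hc]
  rw [tangencyCos]
  linarith

theorem sqrt_one_sub_tangencyCos_sq (ha : 0 < a) (hb : 0 < b) (hc : 0 < c) :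
    √(1 - tangencyCos a b c ^ 2) =
      2 * √(a * (b * c) / (a + (b + c))) * (a + (b + c)) / ((a + b) * (a + c)) := by
  have hsq : √(a * (b * c) / (a + (b + c))) ^ 2 = a * (b * c) / (a + (b + c)) :=
    sq_sqrt (by positivity)
  rw [sqrt_eq_iff_mul_self_eq_of_pos (by positivity), ← sq, div_pow, mul_pow, mul_pow, hsq,
    tangencyCos]
  field_simp
  ring

theorem hasDerivAt_tangencyCos {a b c : ℝ → ℝ} {x y z t : ℝ}
    (ha : HasDerivAt a (a t * x) t) (hb : HasDerivAt b (b t * y) t)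
    (hc : HasDerivAt c (c t * z) t) (ha0 : 0 < a t) (hb0 : 0 < b t) (hc0 : 0 < c t) :
    HasDerivAt (fun s => tangencyCos (a s) (b s) (c s))
      (-(2 * (a t * (b t * c t)) / ((a t + b t) * (a t + c t)) *
        ((y - x) / (a t + b t) + (z - x) / (a t + c t)))) t := by
  have hden : (a t + b t) * (a t + c t) ≠ 0 := by positivity
  refine ((((hb.mul hc).const_mul 2).div ((ha.add hb).mul (ha.add hc)) hden).const_sub
    1).congr_deriv ?_
  simp only [Pi.add_apply, Pi.mul_apply]
  field_simp
  ring

theorem hasDerivAt_arccos_tangencyCos {a b c : ℝ → ℝ} {x y z t : ℝ}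
    (ha : HasDerivAt a (a t * x) t) (hb : HasDerivAt b (b t * y) t)
    (hc : HasDerivAt c (c t * z) t) (ha0 : 0 < a t) (hb0 : 0 < b t) (hc0 : 0 < c t) :
    HasDerivAt (fun s => arccos (tangencyCos (a s) (b s) (c s)))
      (√(a t * (b t * c t) / (a t + (b t + c t))) / (a t + b t) * (y - x) +
        √(a t * (b t * c t) / (a t + (b t + c t))) / (a t + c t) * (z - x)) t := by
  have harccos := hasDerivAt_arccos (neg_one_lt_tangencyCos ha0 hb0 hc0).ne'
    (tangencyCos_lt_one ha0 hb0 hc0).ne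
  rw [sqrt_one_sub_tangencyCos_sq ha0 hb0 hc0] at harccos
  refine (harccos.comp t (hasDerivAt_tangencyCos ha hb hc ha0 hb0 hc0)).congr_deriv ?_
  have hsq := sq_sqrt (x := a t * (b t * c t) / (a t + (b t + c t))) (by positivity)
  have hpos : 0 < √(a t * (b t * c t) / (a t + (b t + c t))) := sqrt_pos.2 (by positivity)
  set r := √(a t * (b t * c t) / (a t + (b t + c t)))
  rw [eq_div_iff (by positivity)] at hsq
  rw [← hsq]
  field_simp

end TangentCircles

section Angle

variable {V : Type*}

/-- The inradius of the triangle whose vertices are the centers of three mutually tangent circles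
of radii `ρ x`, `x ∈ T`. -/
noncomputable def inradius (ρ : V → ℝ) (T : Finset V) : ℝ := √((∏ x ∈ T, ρ x) / ∑ x ∈ T, ρ x)

/-- The contribution of the triangle `T` to the derivative of the angle at `v` with respect to the
logarithm of the radius at `w`: the distance from the incenter to the side `v w`, divided by the
length of that side. -/
noncomputable def tangencyConductance (ρ : V → ℝ) (T : Finset V) (v w : V) : ℝ :=
  inradius ρ T / (ρ v + ρ w)

theorem inradius_pos {ρ : V → ℝ} {T : Finset V} (hρ : ∀ x ∈ T, 0 < ρ x) (hT : T.Nonempty) :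
    0 < inradius ρ T :=
  Real.sqrt_pos.2 (div_pos (Finset.prod_pos hρ) (Finset.sum_pos hρ hT))

theorem tangencyConductance_pos {ρ : V → ℝ} {T : Finset V} {v w : V} (hρ : ∀ x ∈ T, 0 < ρ x)
    (hv : v ∈ T) (hw : w ∈ T) : 0 < tangencyConductance ρ T v w :=
  div_pos (inradius_pos hρ ⟨v, hv⟩) (add_pos (hρ v hv) (hρ w hw))

theorem inradius_le_half {ρ : V → ℝ} {T : Finset V} {v w : V} (hρ : ∀ x ∈ T, 0 < ρ x)
    (hT : T.card = 3) (hv : v ∈ T) (hw : w ∈ T) (hvw : v ≠ w) :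
    inradius ρ T ≤ (ρ v + ρ w) / 2 := by
  classical
  have hw' : w ∈ T.erase v := Finset.mem_erase.2 ⟨hvw.symm, hw⟩
  have hcard : ((T.erase v).erase w).card = 1 := by
    rw [Finset.card_erase_of_mem hw', Finset.card_erase_of_mem hv, hT]
  obtain ⟨z, hz⟩ := Finset.card_eq_one.1 hcard
  have hv0 := hρ v hv
  have hw0 := hρ w hw
  have hz0 : 0 < ρ z := hρ z (Finset.mem_of_mem_erase (Finset.mem_of_mem_erase
    (hz ▸ Finset.mem_singleton_self z : z ∈ (T.erase v).erase w)))
  refine Real.sqrt_le_iff.2 ⟨by positivity, ?_⟩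
  rw [← Finset.mul_prod_erase T ρ hv, ← Finset.mul_prod_erase _ ρ hw',
    ← Finset.add_sum_erase T ρ hv, ← Finset.add_sum_erase _ ρ hw', hz, Finset.prod_singleton,
    Finset.sum_singleton, div_le_iff₀ (by positivity)]
  calc ρ v * (ρ w * ρ z) = ρ v * ρ w * ρ z := by ring
    _ ≤ ((ρ v + ρ w) / 2) ^ 2 * (ρ v + (ρ w + ρ z)) := by
        gcongr
        · nlinarith [sq_nonneg (ρ v - ρ w)]
        · linarith

theorem tangencyConductance_le_half {ρ : V → ℝ} {T : Finset V} {v w : V} (hρ : ∀ x ∈ T, 0 < ρ x)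
    (hT : T.card = 3) (hv : v ∈ T) (hw : w ∈ T) (hvw : v ≠ w) :
    tangencyConductance ρ T v w ≤ 1 / 2 := by
  rw [tangencyConductance, div_le_iff₀ (add_pos (hρ v hv) (hρ w hw))]
  linarith [inradius_le_half hρ hT hv hw hvw]

theorem hasDerivAt_angle [DecidableEq V] {ρ : ℝ → V → ℝ} {u : V → ℝ} {t : ℝ} {T : Finset V} {v : V}
    (hρ : ∀ s, ∀ x ∈ T, 0 < ρ s x) (hderiv : ∀ x ∈ T, HasDerivAt (fun s => ρ s x) (ρ t x * u x) t)
    (hT : T.card = 3) (hv : v ∈ T) :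
    HasDerivAt (fun s => angle (ρ s) v T)
      (∑ w ∈ T.erase v, tangencyConductance (ρ t) T v w * (u w - u v)) t := by
  have hcard : (T.erase v).card = 2 := by rw [Finset.card_erase_of_mem hv, hT]
  obtain ⟨w, z, hwz, herase⟩ := Finset.card_eq_two.1 hcard
  have hw : w ∈ T := Finset.mem_of_mem_erase (a := v) (herase ▸ Finset.mem_insert_self w {z})
  have hz : z ∈ T := Finset.mem_of_mem_erase (a := v) (herase ▸ by simp)
  have hangle (s : ℝ) : angle (ρ s) v T = Real.arccos (tangencyCos (ρ s v) (ρ s w) (ρ s z)) := by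
    rw [tangencyCos_eq (hρ s v hv) (hρ s w hw) (hρ s z hz), angle, herase, Finset.sum_pair hwz,
      Finset.sum_pair hwz, Finset.prod_pair hwz]
  simp only [hangle, tangencyConductance, inradius, ← Finset.mul_prod_erase T (ρ t) hv,
    ← Finset.add_sum_erase T (ρ t) hv, herase, Finset.sum_pair hwz, Finset.prod_pair hwz]
  exact hasDerivAt_arccos_tangencyCos (hderiv v hv) (hderiv w hw) (hderiv z hz) (hρ t v hv)
    (hρ t w hw) (hρ t z hz)

end Angle

section Interpolation

variable {V : Type*} {p q : V → ℝ}

/-- The log-linear interpolation between the positive labels `p` (at time `0`) and `q`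
(at time `1`). -/
noncomputable def logInterp (p q : V → ℝ) (t : ℝ) (v : V) : ℝ :=
  p v * Real.exp (t * Real.log (q v / p v))

/-- The contribution of the triangle `T` to the conductance of the edge `v w` in the network that
compares the labels `p` and `q`: the average of its infinitesimal conductance along the log-linear
interpolation between the labels. -/
noncomputable def triangleConductance (p q : V → ℝ) (T : Finset V) (v w : V) : ℝ :=
  ∫ t in (0 : ℝ)..1, tangencyConductance (logInterp p q t) T v w

theorem logInterp_pos (hp : ∀ v, 0 < p v) (t : ℝ) (v : V) : 0 < logInterp p q t v :=
  mul_pos (hp v) (Real.exp_pos _)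

theorem logInterp_zero : logInterp p q 0 = p := by
  ext v
  simp [logInterp]

theorem logInterp_one (hp : ∀ v, 0 < p v) (hq : ∀ v, 0 < q v) : logInterp p q 1 = q := by
  ext v
  rw [logInterp, one_mul, Real.exp_log (div_pos (hq v) (hp v)), mul_div_cancel₀ _ (hp v).ne']

theorem hasDerivAt_logInterp (t : ℝ) (v : V) :
    HasDerivAt (fun s => logInterp p q s v) (logInterp p q t v * Real.log (q v / p v)) t := by
  refine (((hasDerivAt_id t).mul_const (Real.log (q v / p v))).exp.const_mul (p v)).congr_deriv ?_
  simp [logInterp, mul_assoc]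

theorem continuous_tangencyConductance_logInterp (hp : ∀ v, 0 < p v) {T : Finset V}
    (hT : T.Nonempty) (v w : V) :
    Continuous fun t => tangencyConductance (logInterp p q t) T v w := by
  have hcont (x : V) : Continuous fun t => logInterp p q t x :=
    continuous_iff_continuousAt.2 fun t => (hasDerivAt_logInterp t x).continuousAt
  refine Continuous.div (Continuous.sqrt (Continuous.div ?_ ?_ fun t => ?_)) ?_ fun t => ?_
  · exact continuous_finsetProd _ fun x _ => hcont x
  · exact continuous_finsetSum _ fun x _ => hcont x
  · exact (Finset.sum_pos (fun x _ => logInterp_pos hp t x) hT).ne'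
  · exact (hcont v).add (hcont w)
  · exact (add_pos (logInterp_pos hp t v) (logInterp_pos hp t w)).ne'

theorem triangleConductance_comm (T : Finset V) (v w : V) :
    triangleConductance p q T v w = triangleConductance p q T w v := by
  simp only [triangleConductance, tangencyConductance, add_comm]

theorem triangleConductance_pos (hp : ∀ v, 0 < p v) {T : Finset V} {v w : V} (hv : v ∈ T)
    (hw : w ∈ T) : 0 < triangleConductance p q T v w :=
  intervalIntegral.intervalIntegral_pos_of_pos
    ((continuous_tangencyConductance_logInterp hp ⟨v, hv⟩ v w).intervalIntegrable _ _)
    (fun t => tangencyConductance_pos (fun x _ => logInterp_pos hp t x) hv hw) one_pos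

theorem triangleConductance_le_half (hp : ∀ v, 0 < p v) {T : Finset V} {v w : V} (hT : T.card = 3)
    (hv : v ∈ T) (hw : w ∈ T) (hvw : v ≠ w) : triangleConductance p q T v w ≤ 1 / 2 := calc
  triangleConductance p q T v w ≤ ∫ _ in (0 : ℝ)..1, (1 / 2 : ℝ) :=
    intervalIntegral.integral_mono zero_le_one
      ((continuous_tangencyConductance_logInterp hp ⟨v, hv⟩ v w).intervalIntegrable _ _)
      intervalIntegrable_const
      fun t => tangencyConductance_le_half (fun x _ => logInterp_pos hp t x) hT hv hw hvw
  _ = 1 / 2 := by simp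

theorem angle_sub_angle [DecidableEq V] (hp : ∀ v, 0 < p v) (hq : ∀ v, 0 < q v) {T : Finset V}
    (hT : T.card = 3) {v : V} (hv : v ∈ T) :
    angle q v T - angle p v T = ∑ w ∈ T.erase v, triangleConductance p q T v w *
      (Real.log (q w / p w) - Real.log (q v / p v)) := by
  have hcont (w : V) : Continuous fun t => tangencyConductance (logInterp p q t) T v w *
      (Real.log (q w / p w) - Real.log (q v / p v)) :=
    (continuous_tangencyConductance_logInterp hp ⟨v, hv⟩ v w).mul_const _
  have hftc := intervalIntegral.integral_eq_sub_of_hasDerivAt (a := 0) (b := 1)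
    (fun t _ => hasDerivAt_angle (fun s x _ => logInterp_pos (q := q) hp s x)
      (fun x _ => hasDerivAt_logInterp t x) hT hv)
    ((continuous_finsetSum _ fun w _ => hcont w).intervalIntegrable _ _)
  rw [logInterp_zero, logInterp_one hp hq,
    intervalIntegral.integral_finsetSum fun w _ => (hcont w).intervalIntegrable _ _] at hftc
  simpa only [triangleConductance, intervalIntegral.integral_mul_const] using hftc.symm

end Interpolation

/-- A simplicial complex whose edges each lie on at least one and at most `edgeBound` triangles and
whose vertices each lie on finitely many triangles. No embedding in a surface is required. -/
structure TriangleComplex (V : Type*) extends AbstractSimplicialComplex V where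
  edgeBound : ℕ
  exists_triangle : ∀ e ∈ faces, e.card = 2 → ∃ T ∈ faces, e ⊆ T ∧ T.card = 3
  finite_star : ∀ v : V, {T | T ∈ faces ∧ T.card = 3 ∧ v ∈ T}.Finite
  ncard_triangles_le : ∀ e ∈ faces, e.card = 2 →
    {T | T ∈ faces ∧ T.card = 3 ∧ e ⊆ T}.ncard ≤ edgeBound

namespace TriangleComplex

variable {V : Type*}

/-- The finite set of triangles of `K` that have `v` as a vertex. -/
noncomputable def star (K : TriangleComplex V) (v : V) : Finset (Finset V) :=
  (K.finite_star v).toFinset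

theorem mem_star {K : TriangleComplex V} {v : V} {T : Finset V} :
    T ∈ K.star v ↔ T ∈ K.faces ∧ T.card = 3 ∧ v ∈ T := by
  rw [star, Set.Finite.mem_toFinset, Set.mem_ofPred_eq]

variable [DecidableEq V]

/-- The 1-skeleton of `K`, as a graph. -/
def skeleton (K : TriangleComplex V) : SimpleGraph V where
  Adj u v := u ≠ v ∧ ({u, v} : Finset V) ∈ K.faces
  symm := ⟨fun _ _ h => ⟨h.1.symm, by rw [Finset.pair_comm]; exact h.2⟩⟩
  loopless := ⟨fun _ h => h.1 rfl⟩

/-- The angle sum of the label `ρ` at the vertex `v`. -/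
noncomputable def angleSum (K : TriangleComplex V) (ρ : V → ℝ) (v : V) : ℝ :=
  ∑ T ∈ K.star v, angle ρ v T

variable {K : TriangleComplex V}

theorem skeleton_adj_iff {v w : V} : K.skeleton.Adj v w ↔ ∃ T ∈ K.star v, w ∈ T.erase v := by
  refine ⟨fun ⟨hvw, hface⟩ => ?_, fun ⟨T, hT, hw⟩ => ?_⟩
  · obtain ⟨T, hT, hsub, hcard⟩ := K.exists_triangle _ hface (Finset.card_pair hvw)
    rw [Finset.insert_subset_iff, Finset.singleton_subset_iff] at hsub
    exact ⟨T, mem_star.2 ⟨hT, hcard, hsub.1⟩, Finset.mem_erase.2 ⟨hvw.symm, hsub.2⟩⟩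
  · obtain ⟨hT, -, hv⟩ := mem_star.1 hT
    obtain ⟨hwv, hw⟩ := Finset.mem_erase.1 hw
    exact ⟨hwv.symm, (K.isRelLowerSet_faces hT).2
      (Finset.insert_subset hv (Finset.singleton_subset_iff.2 hw)) (Finset.insert_nonempty v {w})⟩

theorem neighborSet_skeleton (v : V) :
    K.skeleton.neighborSet v = (K.star v).biUnion fun T => T.erase v := by
  ext w
  rw [SimpleGraph.mem_neighborSet, skeleton_adj_iff, Finset.mem_coe, Finset.mem_biUnion]

noncomputable instance : K.skeleton.LocallyFinite := fun v =>
  Set.Finite.fintype (neighborSet_skeleton v ▸ Finset.finite_toSet _)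

theorem card_star_filter_le {v w : V} (h : K.skeleton.Adj v w) :
    {T ∈ K.star v | w ∈ T.erase v}.card ≤ K.edgeBound := by
  rw [← Set.ncard_coe_finset]
  refine (congrArg Set.ncard (Set.ext fun T => ?_)).trans_le
    (K.ncard_triangles_le {v, w} h.2 (Finset.card_pair h.1))
  simp only [Finset.coe_filter, mem_star, Set.mem_ofPred_eq, Finset.insert_subset_iff,
    Finset.singleton_subset_iff, Finset.mem_erase]
  exact ⟨fun ⟨⟨hT, hcard, hv⟩, _, hw⟩ => ⟨hT, hcard, hv, hw⟩,
    fun ⟨hT, hcard, hv, hw⟩ => ⟨⟨hT, hcard, hv⟩, h.1.symm, hw⟩⟩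

variable (K) in
/-- The conductance of the edge `v w` in the network comparing the labels `p` and `q`. -/
noncomputable def edgeConductance (p q : V → ℝ) (v w : V) : ℝ :=
  ∑ T ∈ K.star v with w ∈ T.erase v, triangleConductance p q T v w

variable {p q : V → ℝ}

theorem edgeConductance_comm (v w : V) :
    K.edgeConductance p q v w = K.edgeConductance p q w v := by
  refine Finset.sum_congr (Finset.ext fun T => ?_) fun T _ => triangleConductance_comm T v w
  simp only [Finset.mem_filter, mem_star, Finset.mem_erase, ne_comm (a := w)]
  tauto

theorem adj_of_edgeConductance_ne_zero {v w : V} (h : K.edgeConductance p q v w ≠ 0) :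
    K.skeleton.Adj v w := by
  obtain ⟨T, hT, -⟩ := Finset.exists_ne_zero_of_sum_ne_zero h
  exact skeleton_adj_iff.2 ⟨T, Finset.mem_filter.1 hT⟩

theorem edgeConductance_pos (hp : ∀ v, 0 < p v) {v w : V} (h : K.skeleton.Adj v w) :
    0 < K.edgeConductance p q v w := by
  obtain ⟨T, hT⟩ := skeleton_adj_iff.1 h
  refine Finset.sum_pos (fun T hT => ?_) ⟨T, Finset.mem_filter.2 hT⟩
  obtain ⟨hT, hw⟩ := Finset.mem_filter.1 hT
  exact triangleConductance_pos hp (mem_star.1 hT).2.2 (Finset.mem_of_mem_erase hw)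

theorem edgeConductance_le (hp : ∀ v, 0 < p v) {v w : V} (h : K.skeleton.Adj v w) :
    K.edgeConductance p q v w ≤ K.edgeBound / 2 := calc
  K.edgeConductance p q v w ≤ {T ∈ K.star v | w ∈ T.erase v}.card • (1 / 2 : ℝ) :=
    Finset.sum_le_card_nsmul _ _ _ fun T hT => by
      obtain ⟨hT, hw⟩ := Finset.mem_filter.1 hT
      obtain ⟨-, hcard, hv⟩ := mem_star.1 hT
      exact triangleConductance_le_half hp hcard hv (Finset.mem_of_mem_erase hw) h.1
  _ ≤ K.edgeBound • (1 / 2 : ℝ) := by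
    gcongr
    exact card_star_filter_le h
  _ = K.edgeBound / 2 := by rw [nsmul_eq_mul, mul_one_div]

variable (K) in
/-- The network on the 1-skeleton of `K` in which the Laplacian of the logarithm of the ratio of
the labels `q` and `p` is the difference of their angle sums. -/
noncomputable def network (hp : ∀ v, 0 < p v) (q : V → ℝ) : Network V where
  conductance := K.edgeConductance p q
  conductance_comm := edgeConductance_comm
  conductance_nonneg v w := by
    by_contra! h
    exact h.not_gt (edgeConductance_pos hp (adj_of_edgeConductance_ne_zero h.ne))
  finite_support_conductance v := (K.skeleton.neighborSet v).toFinite.subset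
    fun _ => adj_of_edgeConductance_ne_zero

variable {hp : ∀ v, 0 < p v}

theorem conductance_network_le (v w : V) :
    (K.network hp q).conductance v w ≤
      K.edgeBound / 2 * (unitNetwork K.skeleton).conductance v w := by
  by_cases h : K.skeleton.Adj v w
  · simpa only [network, unitNetwork, if_pos h, mul_one] using edgeConductance_le hp h
  · simpa only [network, unitNetwork, if_neg h, mul_zero] using
      (not_ne_iff.1 (mt adj_of_edgeConductance_ne_zero h)).le

theorem laplacian_network (hq : ∀ v, 0 < q v) (v : V) :
    (K.network hp q).laplacian (fun v => Real.log (q v / p v)) v =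
      K.angleSum p v - K.angleSum q v := by
  have hsupport : Function.support ((K.network hp q).conductance v) ⊆
      K.skeleton.neighborFinset v := fun w hw => by
    simpa using adj_of_edgeConductance_ne_zero hw
  have hangle (T : Finset V) (hT : T ∈ K.star v) : angle p v T - angle q v T =
      ∑ w ∈ T.erase v, triangleConductance p q T v w *
        (Real.log (q v / p v) - Real.log (q w / p w)) := by
    obtain ⟨-, hcard, hv⟩ := mem_star.1 hT
    rw [← neg_sub, angle_sub_angle hp hq hcard hv, ← Finset.sum_neg_distrib]
    exact Finset.sum_congr rfl fun w _ => by ring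
  rw [Network.laplacian_eq_sum hsupport, angleSum, angleSum, ← Finset.sum_sub_distrib,
    Finset.sum_congr rfl hangle]
  simp only [network, edgeConductance, Finset.sum_mul]
  refine Finset.sum_comm' fun w T => ?_
  simp only [SimpleGraph.mem_neighborFinset, skeleton_adj_iff, Finset.mem_filter]
  exact ⟨fun h => h.2.symm, fun h => ⟨⟨T, h.symm⟩, h.symm⟩⟩

end TriangleComplex

section RatioFunction

variable {V : Type*} {K : AbstractSimplicialComplex V} {p q : V → ℝ}

variable (K) in
/-- The function on the polyhedron of `K` that is affine on each simplex and takes the value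
`q v / p v` at each vertex `v`. -/
noncomputable def labelRatio (p q : V → ℝ) (x : realization K) : ℝ :=
  ∑ᶠ v, (x : V → ℝ) v * (q v / p v)

theorem bddAbove_of_isBoundedFun_labelRatio (h : IsBoundedFun (labelRatio K p q)) :
    BddAbove (Set.range fun v => q v / p v) := by
  classical
  obtain ⟨M, hM⟩ := h
  refine ⟨M, Set.forall_mem_range.2 fun v => ?_⟩
  have hv : Pi.single v 1 ∈ realization K :=
    ⟨fun w => (Pi.single_nonneg.2 zero_le_one : (0 : V → ℝ) ≤ Pi.single v 1) w, {v},
      K.singleton_mem v, by simp, by simp⟩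
  have hvertex : labelRatio K p q ⟨_, hv⟩ = q v / p v := by
    rw [labelRatio, finsum_eq_single _ v fun w hw => by simp [hw]]
    simp
  exact hvertex ▸ (le_abs_self _).trans (hM ⟨_, hv⟩)

theorem isConstantFun_labelRatio {c : ℝ} (h : ∀ v, q v / p v = c) :
    IsConstantFun (labelRatio K p q) := by
  refine ⟨c, fun ⟨x, _, T, _, hsupport, hsum⟩ => ?_⟩
  simp only [labelRatio, h]
  rw [finsum_eq_sum_of_support_subset _ fun v hv => hsupport (left_ne_zero_of_mul hv),
    ← Finset.sum_mul, hsum, one_mul]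

end RatioFunction

/-- A triangulation of a plane domain, with its embedding forgotten. -/
def PlaneTriangulation.toTriangleComplex {V : Type*} (K : PlaneTriangulation V) :
    TriangleComplex V where
  toAbstractSimplicialComplex := K.toAbstractSimplicialComplex
  edgeBound := 2
  exists_triangle e he _ := K.exists_triangle e he
  finite_star := K.finite_star
  ncard_triangles_le e he hcard := (K.edge_two e he hcard).le

end CirclePack

open CirclePack in
theorem corollary3p2_general {V : Type*} [DecidableEq V] (K : TriangleComplex V)
    (hK : IsRecurrentGraph K.skeleton) {p q : V → ℝ} (hp : ∀ v, 0 < p v) (hq : ∀ v, 0 < q v)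
    (hpq : ∀ v, K.angleSum p v ≤ K.angleSum q v) :
    ¬ IsBoundedFun (labelRatio K.toAbstractSimplicialComplex p q) ∨
      (IsConstantFun (labelRatio K.toAbstractSimplicialComplex p q) ∧
        IsConstantFun (labelRatio K.toAbstractSimplicialComplex q p)) := by
  refine or_iff_not_imp_left.2 fun hbounded => ?_
  obtain ⟨M, hM⟩ := bddAbove_of_isBoundedFun_labelRatio (not_not.1 hbounded)
  have hpos (v : V) : 0 < q v / p v := div_pos (hq v) (hp v)
  have hlog : BddAbove (Set.range fun v => Real.log (q v / p v)) :=
    ⟨Real.log M, Set.forall_mem_range.2 fun v =>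
      Real.log_le_log (hpos v) (hM (Set.mem_range_self v))⟩
  have hconst (v w : V) : q v / p v = q w / p w := Real.log_injOn_pos (hpos v) (hpos w) <|
    hK.eq_of_subharmonic_of_bddAbove (N := K.network hp q)
      (fun _ _ => TriangleComplex.edgeConductance_pos hp)
      TriangleComplex.conductance_network_le hlog
      (fun v => by rw [TriangleComplex.laplacian_network hq]; linarith [hpq v]) v w
  obtain ⟨c, hc⟩ : ∃ c, ∀ v, q v / p v = c :=
    (isEmpty_or_nonempty V).elim (fun _ => ⟨0, isEmptyElim⟩)
      fun ⟨o⟩ => ⟨q o / p o, fun v => hconst v o⟩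
  exact ⟨isConstantFun_labelRatio hc,
    isConstantFun_labelRatio (c := c⁻¹) fun v => by rw [← hc v, inv_div]⟩

theorem corollary3p2 {V : Type*} [DecidableEq V] (K : CirclePack.PlaneTriangulation V)
    (hK : CirclePack.IsRecurrentGraph K.skeleton) (P Q : CirclePack.CirclePacking K)
    (hPQ : ∀ v : V, P.angleSum v = Q.angleSum v) :
    (¬ CirclePack.IsBoundedFun (CirclePack.ratioFunction P Q) ∧
        ¬ CirclePack.IsBoundedFun (CirclePack.ratioFunction Q P)) ∨
      (CirclePack.IsConstantFun (CirclePack.ratioFunction P Q) ∧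
        CirclePack.IsConstantFun (CirclePack.ratioFunction Q P)) := by
  have dichotomy (P Q : CirclePack.CirclePacking K) (h : ∀ v, P.angleSum v = Q.angleSum v) :
      ¬ CirclePack.IsBoundedFun (CirclePack.ratioFunction P Q) ∨
        (CirclePack.IsConstantFun (CirclePack.ratioFunction P Q) ∧
          CirclePack.IsConstantFun (CirclePack.ratioFunction Q P)) :=
    corollary3p2_general K.toTriangleComplex hK P.radius_pos Q.radius_pos fun v => (h v).le
  have hPQ' := dichotomy P Q hPQ
  have hQP' := dichotomy Q P fun v => (hPQ v).symm
  tauto
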